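/- Let $k\in\mathbb{R}$, $k\neq -1$, and set $\alpha=\frac{1}{1+k}$ and $\beta=\frac{1-k}{1+k}=2\alpha-1$ (so $\alpha$ may lie outside $(0,1)$). Pseudo asymmetric random walk. For $m_0\in\mathbb{Z}$ let $(S_j)_{j\ge 0}$ be the pseudo asymmetric random walk on $\mathbb{Z}$ started at $m_0$: for every $N$, the joint pseudo-law of $(S_0,\dots,S_N)$ is the signed measure that gives each path $(s_0,\dots,s_N)$ with $s_0=m_0$ the mass $\prod_{i=0}^{N-1} q(s_i,s_{i+1})$, where $q(0,1)=\alpha$, $q(0,-1)=1-\alpha$, $q(a,a\pm 1)=\frac12$ for $a\ne 0$, and $q(a,b)=0$ if $|a-b|\ne 1$. Write $\mathbb{E}^{m_0}$ for integration against it. Pseudo skew Brownian motion. With $g(t,x,y)=\frac{1}{\sqrt{2\pi t}}e^{-(y-x)^2/(2t)}$, let \[ p(t,x,y)=\begin{cases}(1-\beta)\,g(t,x,y)& x\ge 0,\ y<0,\\ g(t,x,y)+\beta\, g(t,x,-y)& x>0,\ y>0,\\ (1+\beta)\,g(t,x,y)& x\le 0,\ y>0,\\ g(t,x,y)-\beta\,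 g(t,x,-y)& x<0,\ y<0,\end{cases} \] be the signed Walsh kernel. The pseudo skew Brownian motion $(X_t)_{t\ge0}$ started at $x\in\mathbb{R}$ has $X_0=x$ and, for $0=s_0<s_1<\dots<s_m$, the joint pseudo-law of $(X_{s_1},\dots,X_{s_m})$ is the signed measure with density $\prod_{i=1}^m p(s_i-s_{i-1},y_{i-1},y_i)$ with respect to Lebesgue measure $dy_1\cdots dy_m$, where $y_0=x$. Write $\mathbb{E}^{x}$ for integration against it. Then for every starting point $x\in\mathbb{R}$ the rescaled walk $\widehat X^n=(n^{-1/2}S_{\lfloor nt\rfloor})_{t\ge 0}$ with $S_0=\lfloor\sqrt n\,x\rfloor$ converges to $(X_t)_{t\ge0}$ started at $x$ in the pseudo-weak sense: for all $\ell\ge 1$, all $t_1,\dots,t_\ell\ge 0$ and all $u_1,\dots,u_\ell\in\mathbb{R}$, \[ \lim_{n\to\infty}\mathbb{E}^{\lfloor\sqrt n x\rfloor}\Big[\exp\Big(i\sum_{j=1}^{\ell}u_j\,n^{-1/2}S_{\lfloor nt_j\rfloor}\Big)\Big]=\mathbb{E}^{x}\Big[\exp\Big(i\sum_{j=1}^{\ell}u_jX_{t_j}\Big)\Big].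 \] -/

import Mathlib

open MeasureTheory ProbabilityTheory Filter Topology
open scoped NNReal

namespace PseudoSBM

/-! ### Pseudo-processes and pseudo-weak convergence -/

/-- The finite-dimensional pseudo-laws of a real pseudo-process indexed by `[0, ∞)`: for every
finite set `I` of times, the signed measure on `ℝ^I` that is the joint pseudo-law of the values
at the times in `I`. -/
abbrev PseudoProcess : Type :=
  (I : Finset ℝ≥0) → SignedMeasure (I → ℝ)

/-- The pseudo characteristic function `𝔼[exp (i ∑ⱼ uⱼ Y_{tⱼ})]` of a pseudo-process: the integral
of `exp (i ∑ⱼ uⱼ y_{tⱼ})` against the joint pseudo-law of `Y` at the times `t₁, …, t_ℓ` (which are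
neither required to be ordered nor to be distinct). -/
noncomputable def pseudoCharFun (Y : PseudoProcess) {ℓ : ℕ} (t : Fin ℓ → ℝ≥0) (u : Fin ℓ → ℝ) :
    ℂ :=
  ∫ᵛ y, Complex.exp (Complex.I *
      ((∑ j, u j * y ⟨t j, Finset.mem_image_of_mem t (Finset.mem_univ j)⟩ : ℝ) : ℂ))
    ∂<•(Y (Finset.univ.image t))

/-- Pseudo-weak convergence: all finite-dimensional pseudo characteristic functions converge. -/
def PseudoWeakTendsto {ι : Type*} (Y : ι → PseudoProcess) (F : Filter ι) (X : PseudoProcess) :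
    Prop :=
  ∀ ℓ : ℕ, 0 < ℓ → ∀ (t : Fin ℓ → ℝ≥0) (u : Fin ℓ → ℝ),
    Tendsto (fun i => pseudoCharFun (Y i) t u) F (𝓝 (pseudoCharFun X t u))

/-! ### The pseudo skew Brownian motion -/

/-- The signed Walsh kernel `p(t, x, y)` with parameter `β`, for `t > 0`; here
`gaussianPDFReal x t y` is the density `g(t, x, y)` of the normal law of mean `x` and variance `t`.
The formula leaves out the Lebesgue-null set `y = 0`, on which the kernel is given the value `0`. -/
noncomputable def walshKernel (β : ℝ) (t : ℝ≥0) (x y : ℝ) : ℝ :=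
  if y < 0 then
    if 0 ≤ x then (1 - β) * gaussianPDFReal x t y
    else gaussianPDFReal x t y - β * gaussianPDFReal x t (-y)
  else if 0 < y then
    if x ≤ 0 then (1 + β) * gaussianPDFReal x t y
    else gaussianPDFReal x t y + β * gaussianPDFReal x t (-y)
  else 0

/-- `∏ᵢ p(sᵢ - sᵢ₋₁, yᵢ₋₁, yᵢ)` with `s₀ = 0` and `y₀ = x`: for `0 < s₁ < ⋯ < s_m`, the density on
`ℝ^m` of the joint pseudo-law at the times `s₁, …, s_m` of the pseudo skew Brownian motion
started at `x`. -/
noncomputable def walshDensity (β x : ℝ) {m : ℕ} (s : Fin m → ℝ≥0) (y : Fin m → ℝ) : ℝ :=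
  ∏ i : Fin m, walshKernel β (s i - (Fin.cons 0 s : Fin (m + 1) → ℝ≥0) i.castSucc)
    ((Fin.cons x y : Fin (m + 1) → ℝ) i.castSucc) (y i)

/-- The pseudo skew Brownian motion with parameter `β` started at `x`. For a finite set `I` of
times, the values at the positive times of `I`, listed in increasing order, have the joint density
`walshDensity`, and the value at time `0` is `x`. -/
noncomputable def skewBrownianMotion (β x : ℝ) : PseudoProcess := fun I =>
  ((volume : Measure (Fin (I.erase 0).card → ℝ)).withDensityᵥ
      (walshDensity β x ((I.erase 0).orderEmbOfFin rfl))).map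
    (fun y τ => if h : (τ : ℝ≥0) = 0 then x
      else y (((I.erase 0).orderIsoOfFin rfl).symm ⟨τ, Finset.mem_erase.2 ⟨h, τ.2⟩⟩))

/-! ### The pseudo asymmetric random walk -/

/-- Pseudo transition probabilities of the asymmetric random walk: from `0`, step `+1` with weight
`α` and `-1` with weight `1 - α`; from any other site, both steps have weight `1/2`. -/
noncomputable def stepWeight (α : ℝ) (a b : ℤ) : ℝ :=
  if b = a + 1 then (if a = 0 then α else 1 / 2)
  else if b = a - 1 then (if a = 0 then 1 - α else 1 / 2)
  else 0

/-- The position at time `j` of the path that starts at `m₀` and follows the steps `ε 0, ε 1, …`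
(`true` is a step `+1`, `false` a step `-1`). -/
def walkPath (m₀ : ℤ) {N : ℕ} (ε : Fin N → Bool) (j : ℕ) : ℤ :=
  m₀ + ∑ i : Fin N, if (i : ℕ) < j then (if ε i then 1 else -1) else 0

/-- The pseudo-probability of a path of length `N`: the product of its pseudo transition
probabilities. -/
noncomputable def walkWeight (α : ℝ) (m₀ : ℤ) {N : ℕ} (ε : Fin N → Bool) : ℝ :=
  ∏ i : Fin N, stepWeight α (walkPath m₀ ε i) (walkPath m₀ ε (i + 1))

/-- The joint pseudo-law of `(S₀, …, S_N)` for the pseudo asymmetric random walk `S` with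
parameter `α` started at `m₀`. -/
noncomputable def walkLaw (α : ℝ) (m₀ : ℤ) (N : ℕ) : SignedMeasure (Fin (N + 1) → ℤ) :=
  ∑ ε : Fin N → Bool, VectorMeasure.dirac (fun j : Fin (N + 1) => walkPath m₀ ε j)
    (walkWeight α m₀ ε)

/-- The rescaled pseudo asymmetric random walk `(n^{-1/2} S_{⌊n t⌋})_{t ≥ 0}`, with `S₀ = m₀`. Its
pseudo-law at a finite set `I` of times is the image of the pseudo-law of `(S₀, …, S_N)`, where
`N` is the largest of the `⌊n τ⌋`, `τ ∈ I`. -/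
noncomputable def rescaledWalk (α : ℝ) (m₀ : ℤ) (n : ℕ) : PseudoProcess := fun I =>
  (walkLaw α m₀ (I.sup fun τ => ⌊(n : ℝ≥0) * τ⌋₊)).map
    (fun S τ => (√(n : ℝ))⁻¹ *
      (S ⟨⌊(n : ℝ≥0) * τ⌋₊, Nat.lt_succ_of_le
        (Finset.le_sup (f := fun τ : ℝ≥0 => ⌊(n : ℝ≥0) * τ⌋₊) τ.2)⟩ : ℝ))

end PseudoSBM

namespace PseudoSBM

/-! ### Folding and the symmetric walk -/

/-! The pseudo walk has signed weights, so weak-convergence arguments do not apply to it directly. A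
discrete Walsh formula removes the signs: `N` steps of the pseudo walk applied to `f` equal `N`
steps of the symmetric walk applied to a folded version of `f`, with the fold chosen by the side of
the starting point (`pseudoStep_iterate`). The formula is an algebraic identity in `β`, so it holds
for every real `β`. The limit semigroup `skewHeatOp` is the same formula with Brownian motion in
place of the symmetric walk, and `integral_walshKernel_mul` identifies it with integration against
the Walsh kernel.

By the Markov property a finite-dimensional characteristic function is an iterated operator
`iterOp`: a semigroup step, multiplication by a character, and so on. This holds for the walk
(`walkExpect_prod`) and for the densities (`integral_walshDensityFrom`). It remains to pass to the
limit in nested operators, where the argument of each operator also depends on `n`. Folding,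
symmetric steps and multiplication by characters preserve bounded Lipschitz functions with constants
independent of `n`. Pointwise convergence of such functions is therefore uniform up to an error `ε
(1 + y²)`, and the symmetric walk controls that error through its second moment. With the central
limit theorem this gives one step (`tendsto_skewWalkOp`), and induction gives all of them
(`exists_boundedLip_iterOp`). -/

/-- The function seen by the symmetric process started on the right half-line. -/
noncomputable def foldRight (β : ℝ) (f : ℝ → ℂ) (y : ℝ) : ℂ := f y + β * (f |y| - f y)

/-- The function seen by the symmetric process started on the left half-line. -/
noncomputable def foldLeft (β : ℝ) (f : ℝ → ℂ) (y : ℝ) : ℂ := f y + β * (f y - f (-|y|))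

/-- One step of the symmetric random walk with step size `c`. -/
noncomputable def symStep (c : ℝ) (f : ℝ → ℂ) (x : ℝ) : ℂ := (f (x + c) + f (x - c)) / 2

/-- `N` steps of the skew walk with step size `c`, expressed through the symmetric walk. -/
noncomputable def skewWalkOp (β c : ℝ) (N : ℕ) (f : ℝ → ℂ) (x : ℝ) : ℂ :=
  if 0 ≤ x then (symStep c)^[N] (foldRight β f) x else (symStep c)^[N] (foldLeft β f) x

/-- One step of the pseudo asymmetric random walk. -/
noncomputable def pseudoStep (α : ℝ) (f : ℤ → ℂ) (a : ℤ) : ℂ :=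
  stepWeight α a (a + 1) * f (a + 1) + stepWeight α a (a - 1) * f (a - 1)

lemma foldRight_of_nonneg (β : ℝ) (f : ℝ → ℂ) {y : ℝ} (hy : 0 ≤ y) : foldRight β f y = f y := by
  simp [foldRight, abs_of_nonneg hy]

lemma foldLeft_of_nonpos (β : ℝ) (f : ℝ → ℂ) {y : ℝ} (hy : y ≤ 0) : foldLeft β f y = f y := by
  simp [foldLeft, abs_of_nonpos hy]

/-- The two folds differ by an odd function, which the symmetric walk started at `0` averages to
zero. This makes the two halves of `skewWalkOp` agree at the origin. -/
lemma foldLeft_eq (β : ℝ) (f : ℝ → ℂ) (y : ℝ) :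
    foldLeft β f y = foldRight β f y - β * (f (-y) - f y) := by
  rcases le_total 0 y with h | h
  · simp only [foldLeft, foldRight, abs_of_nonneg h]; ring
  · simp only [foldLeft, foldRight, abs_of_nonpos h, neg_neg]; ring

lemma foldRight_neg (β : ℝ) (f : ℝ → ℂ) (y : ℝ) :
    foldRight β f (-y) = foldRight β f y + (1 - β) * (f (-y) - f y) := by
  simp only [foldRight, abs_neg]; ring

lemma symStep_iterate_add (c : ℝ) (N : ℕ) (f g : ℝ → ℂ) (x : ℝ) :
    (symStep c)^[N] (fun y => f y + g y) x = (symStep c)^[N] f x + (symStep c)^[N] g x := by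
  induction N generalizing x with
  | zero => rfl
  | succ N ih => simp only [Function.iterate_succ_apply', symStep, ih]; ring

lemma symStep_iterate_const_mul (c : ℝ) (N : ℕ) (b : ℂ) (f : ℝ → ℂ) (x : ℝ) :
    (symStep c)^[N] (fun y => b * f y) x = b * (symStep c)^[N] f x := by
  induction N generalizing x with
  | zero => rfl
  | succ N ih => simp only [Function.iterate_succ_apply', symStep, ih]; ring

lemma symStep_iterate_comp_neg (c : ℝ) (N : ℕ) (f : ℝ → ℂ) (x : ℝ) :
    (symStep c)^[N] (fun y => f (-y)) x = (symStep c)^[N] f (-x) := by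
  induction N generalizing x with
  | zero => rfl
  | succ N ih =>
    simp only [Function.iterate_succ_apply', symStep, ih]
    rw [add_comm, show -(x - c) = -x + c by ring, show -(x + c) = -x - c by ring]

lemma symStep_iterate_sub (c : ℝ) (N : ℕ) (f g : ℝ → ℂ) (x : ℝ) :
    (symStep c)^[N] (fun y => f y - g y) x = (symStep c)^[N] f x - (symStep c)^[N] g x := by
  have := symStep_iterate_add c N f (fun y => -1 * g y) x
  rw [symStep_iterate_const_mul] at this
  simpa [sub_eq_add_neg] using this

lemma symStep_iterate_foldLeft (β c : ℝ) (N : ℕ) (f : ℝ → ℂ) (x : ℝ) :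
    (symStep c)^[N] (foldLeft β f) x = (symStep c)^[N] (foldRight β f) x
      - β * ((symStep c)^[N] f (-x) - (symStep c)^[N] f x) := by
  rw [show foldLeft β f = fun y => foldRight β f y - β * (f (-y) - f y) from
    funext (foldLeft_eq β f), symStep_iterate_sub, symStep_iterate_const_mul,
    symStep_iterate_sub, symStep_iterate_comp_neg]

lemma symStep_iterate_foldRight_neg (β c : ℝ) (N : ℕ) (f : ℝ → ℂ) (x : ℝ) :
    (symStep c)^[N] (foldRight β f) (-x) = (symStep c)^[N] (foldRight β f) x
      + (1 - β) * ((symStep c)^[N] f (-x) - (symStep c)^[N] f x) := by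
  rw [← symStep_iterate_comp_neg, show (fun y => foldRight β f (-y)) =
    fun y => foldRight β f y + (1 - β) * (f (-y) - f y) from funext (foldRight_neg β f),
    symStep_iterate_add, symStep_iterate_const_mul, symStep_iterate_sub,
    symStep_iterate_comp_neg]

lemma skewWalkOp_of_nonneg (β c : ℝ) (N : ℕ) (f : ℝ → ℂ) {x : ℝ} (hx : 0 ≤ x) :
    skewWalkOp β c N f x = (symStep c)^[N] (foldRight β f) x := if_pos hx

lemma skewWalkOp_of_nonpos (β c : ℝ) (N : ℕ) (f : ℝ → ℂ) {x : ℝ} (hx : x ≤ 0) :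
    skewWalkOp β c N f x = (symStep c)^[N] (foldLeft β f) x := by
  rcases hx.lt_or_eq with h | rfl
  · exact if_neg h.not_ge
  · rw [skewWalkOp_of_nonneg β c N f le_rfl, symStep_iterate_foldLeft]; simp

/-- The discrete Walsh formula: the `N`-step operator of the pseudo walk on the lattice `c ℤ`. -/
lemma pseudoStep_iterate (β : ℝ) {c : ℝ} (hc : 0 < c) (N : ℕ) (f : ℝ → ℂ) (a : ℤ) :
    (pseudoStep ((1 + β) / 2))^[N] (fun b => f (c * b)) a = skewWalkOp β c N f (c * a) := by
  induction N generalizing a with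
  | zero =>
    rcases le_total 0 (c * (a : ℝ)) with h | h
    · simp [skewWalkOp_of_nonneg β c 0 f h, foldRight_of_nonneg β f h]
    · simp [skewWalkOp_of_nonpos β c 0 f h, foldLeft_of_nonpos β f h]
  | succ N ih =>
    have e1 : c * ((a + 1 : ℤ) : ℝ) = c * a + c := by push_cast; ring
    have e2 : c * ((a - 1 : ℤ) : ℝ) = c * a - c := by push_cast; ring
    rw [Function.iterate_succ_apply', pseudoStep, ih, ih, e1, e2]
    have w1 : stepWeight ((1 + β) / 2) a (a + 1) = if a = 0 then (1 + β) / 2 else 1 / 2 := by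
      simp [stepWeight]
    have w2 : stepWeight ((1 + β) / 2) a (a - 1) = if a = 0 then 1 - (1 + β) / 2 else 1 / 2 := by
      rw [stepWeight, if_neg (by omega), if_pos rfl]
    rw [w1, w2]
    rcases lt_trichotomy a 0 with h | rfl | h
    · have h1 : (a : ℝ) ≤ -1 := by exact_mod_cast (by omega : a ≤ -1)
      rw [skewWalkOp_of_nonpos _ _ _ _ (by nlinarith), skewWalkOp_of_nonpos _ _ _ _ (by nlinarith),
        skewWalkOp_of_nonpos _ _ _ _ (by nlinarith), if_neg h.ne, if_neg h.ne,
        Function.iterate_succ_apply', symStep]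
      push_cast; ring
    -- At the origin the neighbours use different folds. Expressing the left fold at `-c` through
    -- the right fold, and the right fold at `-c` through its value at `c`, reduces the weights `(1
    -- ± β)/2` to a plain symmetric step.
    · rw [skewWalkOp_of_nonneg _ _ _ _ (by simpa using hc.le),
        skewWalkOp_of_nonpos _ _ _ _ (by simpa using hc.le),
        skewWalkOp_of_nonneg _ _ _ _ (by simp), if_pos rfl, if_pos rfl,
        Function.iterate_succ_apply', symStep]
      have h1 := symStep_iterate_foldLeft β c N f (-c)
      have h2 := symStep_iterate_foldRight_neg β c N f c
      rw [neg_neg] at h1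
      simp only [Int.cast_zero, mul_zero, zero_add, zero_sub]
      push_cast
      rw [h1]
      linear_combination (-(β : ℂ) / 2) * h2
    · have h1 : (1 : ℝ) ≤ a := by exact_mod_cast (by omega : 1 ≤ a)
      rw [skewWalkOp_of_nonneg _ _ _ _ (by nlinarith), skewWalkOp_of_nonneg _ _ _ _ (by nlinarith),
        skewWalkOp_of_nonneg _ _ _ _ (by nlinarith), if_neg h.ne', if_neg h.ne',
        Function.iterate_succ_apply', symStep]
      push_cast; ring

/-! ### Bounded Lipschitz functions -/

/-- `f` is bounded by `K` and Lipschitz with constant `L`. -/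
structure BoundedLip (K L : ℝ) (f : ℝ → ℂ) : Prop where
  bound : ∀ x, ‖f x‖ ≤ K
  lip : ∀ x y, ‖f x - f y‖ ≤ L * |x - y|

lemma BoundedLip.continuous {K L : ℝ} {f : ℝ → ℂ} (h : BoundedLip K L f) : Continuous f := by
  have hL : 0 ≤ L := by simpa using (norm_nonneg _).trans (h.lip 1 0)
  exact (LipschitzWith.of_dist_le_mul (K := ⟨L, hL⟩) fun x y => by
    rw [dist_eq_norm, Real.dist_eq]; exact h.lip x y).continuous

lemma BoundedLip.mul {K L K' L' : ℝ} {f g : ℝ → ℂ} (hf : BoundedLip K L f)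
    (hg : BoundedLip K' L' g) : BoundedLip (K * K') (K * L' + L * K') (fun x => f x * g x) := by
  have hK : 0 ≤ K := (norm_nonneg _).trans (hf.bound 0)
  have hL : 0 ≤ L := by simpa using (norm_nonneg _).trans (hf.lip 1 0)
  refine ⟨fun x => ?_, fun x y => ?_⟩
  · rw [norm_mul]; gcongr
    exacts [hf.bound x, hg.bound x]
  · calc ‖f x * g x - f y * g y‖ = ‖f x * (g x - g y) + (f x - f y) * g y‖ := by ring_nf
      _ ≤ ‖f x‖ * ‖g x - g y‖ + ‖f x - f y‖ * ‖g y‖ := by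
        rw [← norm_mul, ← norm_mul]; exact norm_add_le _ _
      _ ≤ K * (L' * |x - y|) + (L * |x - y|) * K' := by
        gcongr
        exacts [hf.bound x, hg.lip x y, hf.lip x y, hg.bound y]
      _ = _ := by ring

lemma BoundedLip.foldRight {K L : ℝ} {f : ℝ → ℂ} (β : ℝ) (h : BoundedLip K L f) :
    BoundedLip (K * (1 + 2 * |β|)) (L * (1 + 2 * |β|)) (foldRight β f) := by
  have hL : 0 ≤ L := by simpa using (norm_nonneg _).trans (h.lip 1 0)
  refine ⟨fun x => ?_, fun x y => ?_⟩
  · calc ‖PseudoSBM.foldRight β f x‖ ≤ ‖f x‖ + |β| * (‖f |x|‖ + ‖f x‖) := by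
          refine (norm_add_le _ _).trans ?_
          rw [norm_mul, Complex.norm_real, Real.norm_eq_abs]
          gcongr; exact norm_sub_le _ _
      _ ≤ K + |β| * (K + K) := by gcongr <;> exact h.bound _
      _ = _ := by ring
  · calc ‖PseudoSBM.foldRight β f x - PseudoSBM.foldRight β f y‖
        = ‖(f x - f y) + β * ((f |x| - f |y|) - (f x - f y))‖ := by
          simp only [PseudoSBM.foldRight]; ring_nf
      _ ≤ ‖f x - f y‖ + |β| * (‖f |x| - f |y|‖ + ‖f x - f y‖) := by
          refine (norm_add_le _ _).trans ?_
          rw [norm_mul, Complex.norm_real, Real.norm_eq_abs]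
          gcongr; exact norm_sub_le _ _
      _ ≤ L * |x - y| + |β| * (L * |x - y| + L * |x - y|) := by
          gcongr
          exacts [h.lip x y,
            (h.lip _ _).trans (mul_le_mul_of_nonneg_left (abs_abs_sub_abs_le_abs_sub x y) hL),
            h.lip x y]
      _ = _ := by ring

lemma BoundedLip.comp_neg {K L : ℝ} {f : ℝ → ℂ} (h : BoundedLip K L f) :
    BoundedLip K L (fun x => f (-x)) :=
  ⟨fun x => h.bound _, fun x y => (h.lip _ _).trans_eq (by
    rw [show -x - -y = -(x - y) by ring, abs_neg])⟩

lemma foldLeft_eq_foldRight_comp_neg (β : ℝ) (f : ℝ → ℂ) (x : ℝ) :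
    foldLeft β f x = foldRight (-β) (fun y => f (-y)) (-x) := by
  simp [foldLeft, foldRight]; ring

lemma BoundedLip.foldLeft {K L : ℝ} {f : ℝ → ℂ} (β : ℝ) (h : BoundedLip K L f) :
    BoundedLip (K * (1 + 2 * |β|)) (L * (1 + 2 * |β|)) (foldLeft β f) := by
  have := (h.comp_neg.foldRight (-β)).comp_neg
  rw [abs_neg] at this
  rwa [show PseudoSBM.foldLeft β f = _ from funext (foldLeft_eq_foldRight_comp_neg β f)]

lemma BoundedLip.symStep {K L : ℝ} {f : ℝ → ℂ} (c : ℝ) (h : BoundedLip K L f) :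
    BoundedLip K L (symStep c f) := by
  refine ⟨fun x => ?_, fun x y => ?_⟩
  · rw [PseudoSBM.symStep, norm_div, Complex.norm_ofNat]
    have := norm_add_le (f (x + c)) (f (x - c))
    linarith [h.bound (x + c), h.bound (x - c)]
  · have e : PseudoSBM.symStep c f x - PseudoSBM.symStep c f y
        = ((f (x + c) - f (y + c)) + (f (x - c) - f (y - c))) / 2 := by
      simp only [PseudoSBM.symStep]; ring
    rw [e, norm_div, Complex.norm_ofNat]
    have := norm_add_le (f (x + c) - f (y + c)) (f (x - c) - f (y - c))
    have h1 := h.lip (x + c) (y + c)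
    have h2 := h.lip (x - c) (y - c)
    rw [add_sub_add_right_eq_sub] at h1
    rw [sub_sub_sub_cancel_right] at h2
    linarith

lemma BoundedLip.symStep_iterate {K L : ℝ} {f : ℝ → ℂ} (c : ℝ) (N : ℕ) (h : BoundedLip K L f) :
    BoundedLip K L ((PseudoSBM.symStep c)^[N] f) := by
  induction N with
  | zero => exact h
  | succ N ih => rw [Function.iterate_succ_apply']; exact ih.symStep c

lemma BoundedLip.skewWalkOp {K L : ℝ} {f : ℝ → ℂ} (β c : ℝ) (N : ℕ) (h : BoundedLip K L f) :
    BoundedLip (K * (1 + 2 * |β|)) (L * (1 + 2 * |β|)) (skewWalkOp β c N f) := by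
  have hr := (h.foldRight β).symStep_iterate c N
  have hl := (h.foldLeft β).symStep_iterate c N
  -- For points on opposite sides, compare through `0`, where both branches agree; since `|x| + |y|
  -- = |x - y|` here, the Lipschitz constant does not grow.
  have key : ∀ x y, x ≤ 0 → 0 ≤ y →
      ‖PseudoSBM.skewWalkOp β c N f x - PseudoSBM.skewWalkOp β c N f y‖
        ≤ L * (1 + 2 * |β|) * |x - y| := by
    intro x y hx hy
    have h1 := hl.lip x 0
    have h2 := hr.lip 0 y
    rw [← skewWalkOp_of_nonpos β c N f le_rfl, ← skewWalkOp_of_nonpos β c N f hx] at h1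
    rw [← skewWalkOp_of_nonneg β c N f le_rfl, ← skewWalkOp_of_nonneg β c N f hy] at h2
    refine (norm_sub_le_norm_sub_add_norm_sub _ _ _).trans ((add_le_add h1 h2).trans_eq ?_)
    rw [← mul_add, abs_of_nonpos (by linarith : x - 0 ≤ 0), abs_of_nonpos (by linarith : 0 - y ≤ 0),
      abs_of_nonpos (by linarith : x - y ≤ 0)]
    ring
  refine ⟨fun x => ?_, fun x y => ?_⟩
  · rw [PseudoSBM.skewWalkOp]; split_ifs
    exacts [hr.bound x, hl.bound x]
  · rcases le_total 0 x with hx | hx <;> rcases le_total 0 y with hy | hy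
    · rw [skewWalkOp_of_nonneg β c N f hx, skewWalkOp_of_nonneg β c N f hy]; exact hr.lip x y
    · rw [norm_sub_rev, abs_sub_comm]; exact key y x hy hx
    · exact key x y hx hy
    · rw [skewWalkOp_of_nonpos β c N f hx, skewWalkOp_of_nonpos β c N f hy]; exact hl.lip x y

/-- A symmetric step sends `y²` to `y² + c²`, so this is the second moment of the walk. -/
lemma norm_symStep_iterate_le (c ε : ℝ) (N : ℕ) (f : ℝ → ℂ) (h : ∀ y, ‖f y‖ ≤ ε * (1 + y ^ 2))
    (x : ℝ) : ‖(symStep c)^[N] f x‖ ≤ ε * (1 + x ^ 2 + N * c ^ 2) := by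
  induction N generalizing x with
  | zero => simpa using h x
  | succ N ih =>
    rw [Function.iterate_succ_apply', symStep, norm_div, Complex.norm_ofNat]
    have := norm_add_le ((symStep c)^[N] f (x + c)) ((symStep c)^[N] f (x - c))
    have h1 := ih (x + c)
    have h2 := ih (x - c)
    push_cast
    nlinarith

/-! ### The central limit theorem for the symmetric walk -/

/-- The law of the symmetric walk with step size `c` after `N` steps from `0`. -/
noncomputable def symLaw (c : ℝ) : ℕ → Measure ℝ
  | 0 => Measure.dirac 0
  | N + 1 => (2⁻¹ : ℝ≥0) • ((symLaw c N).map (· + c) + (symLaw c N).map (· - c))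

instance isProbabilityMeasure_symLaw (c : ℝ) (N : ℕ) : IsProbabilityMeasure (symLaw c N) := by
  induction N with
  | zero => rw [symLaw]; infer_instance
  | succ N ih =>
    constructor
    rw [symLaw, Measure.smul_apply, Measure.add_apply,
      Measure.map_apply (by fun_prop) MeasurableSet.univ,
      Measure.map_apply (by fun_prop) MeasurableSet.univ]
    simp only [Set.preimage_univ, measure_univ]
    rw [one_add_one_eq_two, ENNReal.smul_def, smul_eq_mul, ENNReal.coe_inv two_ne_zero]
    exact ENNReal.inv_mul_cancel (by simp) (by simp)

lemma BoundedLip.integrable {K L : ℝ} {f : ℝ → ℂ} (h : BoundedLip K L f) (μ : Measure ℝ)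
    [IsFiniteMeasure μ] : Integrable f μ :=
  Integrable.of_bound h.continuous.aestronglyMeasurable K (ae_of_all _ h.bound)

lemma BoundedLip.comp_add {K L : ℝ} {f : ℝ → ℂ} (h : BoundedLip K L f) (a : ℝ) :
    BoundedLip K L (fun x => f (a + x)) :=
  ⟨fun x => h.bound _, fun x y => by simpa using h.lip (a + x) (a + y)⟩

lemma symStep_iterate_eq_integral {K L : ℝ} {f : ℝ → ℂ} (h : BoundedLip K L f) (c : ℝ) (N : ℕ)
    (x : ℝ) : (symStep c)^[N] f x = ∫ s, f (x + s) ∂(symLaw c N) := by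
  induction N generalizing x with
  | zero => simp [symLaw]
  | succ N ih =>
    have hf := h.comp_add x
    rw [Function.iterate_succ_apply', symStep, ih, ih, symLaw, integral_smul_nnreal_measure,
      integral_add_measure (hf.integrable _) (hf.integrable _),
      integral_map (by fun_prop) hf.continuous.aestronglyMeasurable,
      integral_map (by fun_prop) hf.continuous.aestronglyMeasurable, NNReal.smul_def]
    simp only [NNReal.coe_inv, NNReal.coe_ofNat, Complex.real_smul,
      show ∀ s, x + c + s = x + (s + c) from fun s => by ring,
      show ∀ s, x - c + s = x + (s - c) from fun s => by ring]
    push_cast; ring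

lemma norm_exp_I_mul_real (a : ℝ) : ‖Complex.exp (Complex.I * a)‖ = 1 := by
  rw [mul_comm, Complex.norm_exp_ofReal_mul_I]

/-- The character `y ↦ exp (i u y)`. -/
noncomputable def character (u y : ℝ) : ℂ := Complex.exp (Complex.I * ((u * y : ℝ) : ℂ))

lemma boundedLip_character (u : ℝ) : BoundedLip 1 |u| (character u) := by
  refine ⟨fun x => (norm_exp_I_mul_real _).le, fun x y => ?_⟩
  have h := Real.norm_exp_I_mul_ofReal_sub_one_le (x := u * (x - y))
  have e : character u x - character u y
      = character u y * (Complex.exp (Complex.I * ((u * (x - y) : ℝ) : ℂ)) - 1) := by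
    rw [character, character, mul_sub, ← Complex.exp_add, mul_one]
    push_cast; ring_nf
  rw [e, norm_mul, character, norm_exp_I_mul_real, one_mul, ← abs_mul]
  exact h

/-- Characters are eigenfunctions of the symmetric step, with eigenvalue `cos (u c)`. -/
lemma symStep_iterate_character (c u : ℝ) (N : ℕ) (x : ℝ) :
    (symStep c)^[N] (character u) x = (Real.cos (u * c) : ℂ) ^ N * character u x := by
  induction N generalizing x with
  | zero => simp
  | succ N ih =>
    rw [Function.iterate_succ_apply', symStep, ih, ih, pow_succ, Complex.ofReal_cos, Complex.cos]
    have e1 : character u (x + c) = character u x * Complex.exp (((u * c : ℝ) : ℂ) * Complex.I) := by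
      rw [character, character, ← Complex.exp_add]; push_cast; ring_nf
    have e2 : character u (x - c) = character u x * Complex.exp (-((u * c : ℝ) : ℂ) * Complex.I) := by
      rw [character, character, ← Complex.exp_add]; push_cast; ring_nf
    rw [e1, e2]; ring

lemma charFun_symLaw (c : ℝ) (N : ℕ) (u : ℝ) : charFun (symLaw c N) u = Real.cos (u * c) ^ N := by
  have := symStep_iterate_eq_integral (boundedLip_character u) c N 0
  rw [symStep_iterate_character] at this
  rw [charFun_apply_real]
  simp only [zero_add] at this
  simp only [character, mul_zero, Complex.ofReal_zero, Complex.exp_zero, mul_one] at this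
  rw [this]
  congr 1 with s
  push_cast; ring_nf

lemma tendsto_mul_cos_inv_sqrt_sub_one (u : ℝ) :
    Tendsto (fun n : ℕ => (n : ℝ) * (Real.cos (u * (√(n : ℝ))⁻¹) - 1)) atTop (𝓝 (-(u ^ 2 / 2))) := by
  have hz : Tendsto (fun n : ℕ => (√(n : ℝ))⁻¹) atTop (𝓝 0) :=
    tendsto_inv_atTop_zero.comp (Real.tendsto_sqrt_atTop.comp tendsto_natCast_atTop_atTop)
  have hsmall : ∀ᶠ n : ℕ in atTop, |u * (√(n : ℝ))⁻¹| ≤ 1 := by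
    have : Tendsto (fun n : ℕ => |u * (√(n : ℝ))⁻¹|) atTop (𝓝 0) := by
      simpa using (hz.const_mul u).abs
    exact this.eventually_le_const one_pos
  rw [← tendsto_sub_nhds_zero_iff]
  -- The constant `5/96` is that of `Real.cos_bound`; its fourth-order error is of size `n⁻²`, hence
  -- `n⁻¹` after multiplication by `n`.
  refine squeeze_zero_norm' (a := fun n : ℕ => u ^ 4 * (5 / 96) * ((√(n : ℝ))⁻¹ ^ 2)) ?_
    (by simpa using (hz.pow 2).const_mul (u ^ 4 * (5 / 96)))
  filter_upwards [hsmall, eventually_gt_atTop 0] with n hn hn0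
  have hn0' : (0 : ℝ) < n := by exact_mod_cast hn0
  have hs : (√(n : ℝ))⁻¹ ^ 2 = (n : ℝ)⁻¹ := by rw [inv_pow, Real.sq_sqrt hn0'.le]
  have hb := Real.cos_bound hn
  have e4 : |u * (√(n : ℝ))⁻¹| ^ 4 = u ^ 4 * (n : ℝ)⁻¹ ^ 2 := by
    rw [← hs, Even.pow_abs (by decide)]; ring
  have e2 : (u * (√(n : ℝ))⁻¹) ^ 2 = u ^ 2 * (n : ℝ)⁻¹ := by rw [mul_pow, hs]
  rw [e4, e2] at hb
  have e : (n : ℝ) * (Real.cos (u * (√(n : ℝ))⁻¹) - 1) - -(u ^ 2 / 2)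
      = n * (Real.cos (u * (√(n : ℝ))⁻¹) - (1 - u ^ 2 * (n : ℝ)⁻¹ / 2)) := by
    field_simp; ring
  rw [e, hs, Real.norm_eq_abs, abs_mul, abs_of_pos hn0']
  calc _ ≤ n * (u ^ 4 * (n : ℝ)⁻¹ ^ 2 * (5 / 96)) := by gcongr
    _ = _ := by field_simp

lemma tendsto_cos_inv_sqrt_pow (u : ℝ) {N : ℕ → ℕ} {t : ℝ}
    (hN : Tendsto (fun n : ℕ => (N n : ℝ) / n) atTop (𝓝 t)) :
    Tendsto (fun n : ℕ => Real.cos (u * (√(n : ℝ))⁻¹) ^ N n) atTop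
      (𝓝 (Real.exp (-(t * u ^ 2 / 2)))) := by
  have h1 := Real.tendsto_one_add_pow_exp_of_tendsto (tendsto_mul_cos_inv_sqrt_sub_one u)
  simp only [add_sub_cancel] at h1
  have hpos : ∀ᶠ n : ℕ in atTop, 0 < Real.cos (u * (√(n : ℝ))⁻¹) := by
    have hz : Tendsto (fun n : ℕ => (√(n : ℝ))⁻¹) atTop (𝓝 0) :=
      tendsto_inv_atTop_zero.comp (Real.tendsto_sqrt_atTop.comp tendsto_natCast_atTop_atTop)
    have : Tendsto (fun n : ℕ => Real.cos (u * (√(n : ℝ))⁻¹)) atTop (𝓝 1) := by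
      simpa [Function.comp_def] using (Real.continuous_cos.tendsto _).comp (hz.const_mul u)
    exact this.eventually_const_lt one_pos
  have h2 := h1.log (Real.exp_pos _).ne'
  -- Once the cosine is positive, `cos ^ N = exp ((N / n) * log (cos ^ n))`, which reduces the
  -- exponent `N n` to the exponent `n`.
  have h3 := (Real.continuous_exp.tendsto _).comp (hN.mul h2)
  rw [Real.log_exp, show t * -(u ^ 2 / 2) = -(t * u ^ 2 / 2) by ring] at h3
  refine h3.congr' ?_
  filter_upwards [hpos, eventually_gt_atTop 0] with n hn hn0
  have hn0' : (n : ℝ) ≠ 0 := by exact_mod_cast hn0.ne'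
  rw [Function.comp_apply, Real.log_pow, ← mul_assoc, div_mul_cancel₀ _ hn0', ← Real.log_pow,
    Real.exp_log (pow_pos hn _)]

lemma tendsto_symStep_iterate {K L : ℝ} {f : ℝ → ℂ} (h : BoundedLip K L f) {N : ℕ → ℕ} {t : ℝ≥0}
    (hN : Tendsto (fun n : ℕ => (N n : ℝ) / n) atTop (𝓝 t)) (x : ℝ) :
    Tendsto (fun n : ℕ => (symStep (√(n : ℝ))⁻¹)^[N n] f x) atTop
      (𝓝 (∫ s, f (x + s) ∂(gaussianReal 0 t))) := by
  simp only [symStep_iterate_eq_integral h]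
  let μ : ℕ → ProbabilityMeasure ℝ := fun n => ⟨symLaw (√(n : ℝ))⁻¹ (N n), inferInstance⟩
  let γ : ProbabilityMeasure ℝ := ⟨gaussianReal 0 t, inferInstance⟩
  have hw : Tendsto μ atTop (𝓝 γ) := by
    refine ProbabilityMeasure.tendsto_of_tendsto_charFun fun u => ?_
    have e : charFun (γ : Measure ℝ) u = ((Real.exp (-(t * u ^ 2 / 2)) : ℝ) : ℂ) := by
      change charFun (gaussianReal 0 t) u = _
      rw [charFun_gaussianReal]; push_cast; simp
    rw [e]
    have := (Complex.continuous_ofReal.tendsto _).comp (tendsto_cos_inv_sqrt_pow u hN)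
    refine this.congr fun n => ?_
    change _ = charFun (symLaw _ _) u
    rw [charFun_symLaw]; simp
  rw [ProbabilityMeasure.tendsto_iff_forall_integral_rclike_tendsto ℂ] at hw
  exact hw (BoundedContinuousFunction.ofNormedAddCommGroup _ (h.comp_add x).continuous K
    (h.comp_add x).bound)

/-! ### One step of the limiting process -/

/-- The semigroup of the skew Brownian motion, expressed through Brownian motion. -/
noncomputable def skewHeatOp (β : ℝ) (t : ℝ≥0) (f : ℝ → ℂ) (x : ℝ) : ℂ :=
  if 0 ≤ x then ∫ s, foldRight β f (x + s) ∂(gaussianReal 0 t)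
  else ∫ s, foldLeft β f (x + s) ∂(gaussianReal 0 t)

/-- On a compact interval, equi-Lipschitz bounds turn convergence on a finite net into uniform
convergence; outside it, the uniform bound `2 K` is absorbed by `ε y²`. -/
lemma eventually_norm_sub_le {K L : ℝ} {f : ℕ → ℝ → ℂ} {g : ℝ → ℂ}
    (hf : ∀ n, BoundedLip K L (f n)) (hg : BoundedLip K L g)
    (h : ∀ x, Tendsto (fun n => f n x) atTop (𝓝 (g x))) {ε : ℝ} (hε : 0 < ε) :
    ∀ᶠ n in atTop, ∀ y, ‖f n y - g y‖ ≤ ε * (1 + y ^ 2) := by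
  have hK : 0 ≤ K := (norm_nonneg _).trans (hg.bound 0)
  have hL : 0 ≤ L := by simpa using (norm_nonneg _).trans (hg.lip 1 0)
  -- The radius gives `2 K ≤ ε R`, and `R ≥ 1` gives `R ≤ y²` as soon as `R ≤ |y|`.
  set R : ℝ := 2 * K / ε + 1 with hR
  have hR1 : 1 ≤ R := by rw [hR]; have : 0 ≤ 2 * K / ε := by positivity
                         linarith
  -- The net is fine enough for the two Lipschitz errors to total at most `ε / 2`; the `+ 1` covers
  -- `L = 0`.
  set δ : ℝ := ε / (2 * (2 * L + 1)) with hδ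
  have hδ0 : 0 < δ := by positivity
  obtain ⟨s, -, hs, hcov⟩ := (isCompact_Icc (a := -R) (b := R)).finite_cover_balls hδ0
  have hev : ∀ᶠ n in atTop, ∀ x ∈ s, ‖f n x - g x‖ < ε / 2 := by
    rw [eventually_all_finite hs]
    intro x _
    have := (tendsto_iff_norm_sub_tendsto_zero.1 (h x))
    exact this.eventually_lt_const (by positivity)
  filter_upwards [hev] with n hn y
  by_cases hy : y ∈ Set.Icc (-R) R
  · obtain ⟨x, hx, hxy⟩ := Set.mem_iUnion₂.1 (hcov hy)
    rw [Metric.mem_ball, Real.dist_eq] at hxy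
    have h1 := (hf n).lip y x
    have h2 := hg.lip x y
    have h3 := hn x hx
    rw [abs_sub_comm] at h2
    have h4 : 2 * L * |y - x| ≤ ε / 2 := by
      calc 2 * L * |y - x| ≤ (2 * L + 1) * δ := by gcongr; linarith
        _ = ε / 2 := by rw [hδ]; field_simp
    have e : f n y - g y = (f n y - f n x) + (f n x - g x) + (g x - g y) := by ring
    have h5 : ‖f n y - g y‖ ≤ ‖f n y - f n x‖ + ‖f n x - g x‖ + ‖g x - g y‖ := by
      rw [e]; exact norm_add₃_le
    nlinarith [sq_nonneg y]
  · have hy2 : R ≤ |y| := by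
      by_contra hlt
      exact hy (abs_le.1 (not_le.1 hlt).le)
    have h1 : ‖f n y - g y‖ ≤ 2 * K := by
      have := norm_sub_le (f n y) (g y)
      linarith [(hf n).bound y, hg.bound y]
    have h2 : R ≤ y ^ 2 := by rw [← sq_abs]; nlinarith
    have h3 : 2 * K ≤ ε * R := by rw [hR, mul_add, mul_div_cancel₀ _ hε.ne']; linarith
    nlinarith

lemma tendsto_symStep_iterate_of_tendsto {K L : ℝ} {f : ℕ → ℝ → ℂ} {g : ℝ → ℂ}
    (hf : ∀ n, BoundedLip K L (f n)) (hg : BoundedLip K L g)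
    (h : ∀ x, Tendsto (fun n => f n x) atTop (𝓝 (g x))) {N : ℕ → ℕ} {t : ℝ≥0}
    (hN : Tendsto (fun n : ℕ => (N n : ℝ) / n) atTop (𝓝 t)) (x : ℝ) :
    Tendsto (fun n : ℕ => (symStep (√(n : ℝ))⁻¹)^[N n] (f n) x) atTop
      (𝓝 (∫ s, g (x + s) ∂(gaussianReal 0 t))) := by
  have h1 := tendsto_symStep_iterate hg hN x
  have h2 : Tendsto (fun n : ℕ => (symStep (√(n : ℝ))⁻¹)^[N n] (fun y => f n y - g y) x) atTop
      (𝓝 0) := by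
    rw [Metric.tendsto_nhds]
    intro ε hε
    -- With `c² = 1 / n`, the second-moment factor is `1 + x² + N n / n`, eventually below `2 + x² +
    -- t`.
    have hC : 0 < 2 + x ^ 2 + (t : ℝ) := by positivity
    filter_upwards [eventually_norm_sub_le hf hg h (div_pos hε hC),
      hN.eventually_lt_const (lt_add_one (t : ℝ)), eventually_gt_atTop 0] with n hn hn1 hn0
    have hn0' : (0 : ℝ) < n := by exact_mod_cast hn0
    rw [dist_zero_right]
    refine (norm_symStep_iterate_le _ _ _ _ hn x).trans_lt ?_
    rw [inv_pow, Real.sq_sqrt hn0'.le, ← div_eq_mul_inv]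
    calc _ < ε / (2 + x ^ 2 + t) * (2 + x ^ 2 + t) :=
          mul_lt_mul_of_pos_left (by linarith) (by positivity)
      _ = ε := div_mul_cancel₀ _ hC.ne'
  have h3 := h2.add h1
  simp only [symStep_iterate_sub, sub_add_cancel, zero_add] at h3
  exact h3

lemma tendsto_skewWalkOp (β : ℝ) {K L : ℝ} {f : ℕ → ℝ → ℂ} {g : ℝ → ℂ}
    (hf : ∀ n, BoundedLip K L (f n)) (hg : BoundedLip K L g)
    (h : ∀ x, Tendsto (fun n => f n x) atTop (𝓝 (g x))) {N : ℕ → ℕ} {t : ℝ≥0}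
    (hN : Tendsto (fun n : ℕ => (N n : ℝ) / n) atTop (𝓝 t)) (x : ℝ) :
    Tendsto (fun n : ℕ => skewWalkOp β (√(n : ℝ))⁻¹ (N n) (f n) x) atTop
      (𝓝 (skewHeatOp β t g x)) := by
  rw [skewHeatOp]
  simp only [skewWalkOp]
  split_ifs
  · refine tendsto_symStep_iterate_of_tendsto (fun n => (hf n).foldRight β) (hg.foldRight β)
      (fun y => ?_) hN x
    exact (h y).add (((h _).sub (h y)).const_mul _)
  · refine tendsto_symStep_iterate_of_tendsto (fun n => (hf n).foldLeft β) (hg.foldLeft β)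
      (fun y => ?_) hN x
    exact (h y).add (((h y).sub (h _)).const_mul _)

lemma BoundedLip.of_tendsto {K L : ℝ} {f : ℕ → ℝ → ℂ} {g : ℝ → ℂ}
    (hf : ∀ n, BoundedLip K L (f n)) (h : ∀ x, Tendsto (fun n => f n x) atTop (𝓝 (g x))) :
    BoundedLip K L g :=
  ⟨fun x => le_of_tendsto (h x).norm (.of_forall fun n => (hf n).bound x),
    fun x y => le_of_tendsto ((h x).sub (h y)).norm (.of_forall fun n => (hf n).lip x y)⟩

/-! ### Iterated operators -/

/-- The operators `K (s₀ - r)`, `K (s₁ - s₀)`, …, each followed by multiplication with the functions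
`ψ v₀`, `ψ v₁`, …, composed and applied to `1`. -/
noncomputable def iterOp {E T : Type*} [Sub T] (K : T → (E → ℂ) → E → ℂ) (ψ : ℝ → E → ℂ) :
    (m : ℕ) → T → (Fin m → T) → (Fin m → ℝ) → E → ℂ
  | 0, _, _, _ => fun _ => 1
  | m + 1, r, s, v =>
    K (s 0 - r) (fun y => ψ (v 0) y * iterOp K ψ m (s 0) (Fin.tail s) (Fin.tail v) y)

lemma iterOp_pseudoStep (β : ℝ) {c : ℝ} (hc : 0 < c) (m r : ℕ) (s : Fin m → ℕ) (v : Fin m → ℝ)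
    (a : ℤ) :
    iterOp (fun N => (pseudoStep ((1 + β) / 2))^[N]) (fun u b => character u (c * b)) m r s v a
      = iterOp (skewWalkOp β c) character m r s v (c * a) := by
  induction m generalizing r a with
  | zero => rfl
  | succ m ih =>
    simp only [iterOp, ih]
    exact pseudoStep_iterate β hc _
      (fun y => character (v 0) y * iterOp (skewWalkOp β c) character m (s 0) (Fin.tail s)
        (Fin.tail v) y) a

lemma tendsto_floor_sub_div {r s : ℝ≥0} (h : r ≤ s) :
    Tendsto (fun n : ℕ => ((⌊(n : ℝ≥0) * s⌋₊ - ⌊(n : ℝ≥0) * r⌋₊ : ℕ) : ℝ) / n) atTop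
      (𝓝 ((s - r : ℝ≥0) : ℝ)) := by
  have key : ∀ q : ℝ≥0, Tendsto (fun n : ℕ => ((⌊(n : ℝ≥0) * q⌋₊ : ℕ) : ℝ) / n) atTop (𝓝 q) := by
    intro q
    have := (tendsto_nat_floor_mul_div_atTop (R := ℝ) q.2).comp tendsto_natCast_atTop_atTop
    refine this.congr fun n => ?_
    have e : ⌊(n : ℝ≥0) * q⌋₊ = ⌊(q : ℝ) * n⌋₊ := by
      refine eq_of_forall_le_iff fun k => ?_
      rw [Nat.le_floor_iff zero_le, Nat.le_floor_iff (by positivity), mul_comm]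
      exact_mod_cast Iff.rfl
    rw [e]; rfl
  rw [NNReal.coe_sub h]
  refine ((key s).sub (key r)).congr fun n => ?_
  rw [Nat.cast_sub (Nat.floor_mono (by gcongr)), sub_div]

/-- The bounds and the convergence are proved together: passing one more operator to the limit
requires bounded Lipschitz constants for its argument that do not depend on `n`. -/
lemma exists_boundedLip_iterOp (β : ℝ) (m : ℕ) (r : ℝ≥0) (s : Fin m → ℝ≥0) (v : Fin m → ℝ)
    (hr : ∀ i, r ≤ s i) (hs : Monotone s) :
    ∃ K L, (∀ n : ℕ, BoundedLip K L (iterOp (skewWalkOp β (√(n : ℝ))⁻¹) character m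
        ⌊(n : ℝ≥0) * r⌋₊ (fun i => ⌊(n : ℝ≥0) * s i⌋₊) v)) ∧
      ∀ x, Tendsto (fun n : ℕ => iterOp (skewWalkOp β (√(n : ℝ))⁻¹) character m
        ⌊(n : ℝ≥0) * r⌋₊ (fun i => ⌊(n : ℝ≥0) * s i⌋₊) v x) atTop
        (𝓝 (iterOp (skewHeatOp β) character m r s v x)) := by
  induction m generalizing r with
  | zero =>
    exact ⟨1, 0, fun n => ⟨fun x => by simp [iterOp], fun x y => by simp [iterOp]⟩,
      fun x => tendsto_const_nhds⟩
  | succ m ih =>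
    obtain ⟨K, L, h1, h2⟩ := ih (s 0) (Fin.tail s) (Fin.tail v) (fun i => hs (Fin.zero_le _))
      (fun i j hij => hs (Fin.succ_le_succ_iff.2 hij))
    have h3 := fun n => (boundedLip_character (v 0)).mul (h1 n)
    have h4 := (boundedLip_character (v 0)).mul (BoundedLip.of_tendsto h1 h2)
    refine ⟨_, _, fun n => (h3 n).skewWalkOp β _ _, fun x => ?_⟩
    exact tendsto_skewWalkOp β h3 h4 (fun y => (h2 y).const_mul _)
      (tendsto_floor_sub_div (hr 0)) x

/-! ### The Markov property of the pseudo random walk -/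

/-- The expectation of a functional of the pseudo random walk of length `N`. -/
noncomputable def walkExpect (α : ℝ) (N : ℕ) (a : ℤ) (F : (ℕ → ℤ) → ℂ) : ℂ :=
  ∑ ε : Fin N → Bool, (walkWeight α a ε : ℂ) * F (walkPath a ε)

/-- Prepend a value to a path. -/
def consPath (a : ℤ) (p : ℕ → ℤ) : ℕ → ℤ
  | 0 => a
  | j + 1 => p j

lemma walkPath_zero (a : ℤ) {N : ℕ} (ε : Fin N → Bool) : walkPath a ε 0 = a := by
  simp [walkPath]

lemma walkPath_cons (a : ℤ) {N : ℕ} (b : Bool) (ε : Fin N → Bool) :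
    walkPath a (Fin.cons b ε : Fin (N + 1) → Bool)
      = consPath a (walkPath (a + if b then 1 else -1) ε) := by
  funext j
  cases j with
  | zero => simp [walkPath_zero, consPath]
  | succ j => simp [consPath, walkPath, Fin.sum_univ_succ, add_assoc]

lemma walkWeight_cons (α : ℝ) (a : ℤ) {N : ℕ} (b : Bool) (ε : Fin N → Bool) :
    walkWeight α a (Fin.cons b ε : Fin (N + 1) → Bool)
      = stepWeight α a (a + if b then 1 else -1) * walkWeight α (a + if b then 1 else -1) ε := by
  rw [walkWeight, Fin.prod_univ_succ, walkPath_cons]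
  simp [consPath, walkWeight, walkPath_zero]

lemma walkExpect_succ (α : ℝ) (N : ℕ) (a : ℤ) (F : (ℕ → ℤ) → ℂ) :
    walkExpect α (N + 1) a F
      = pseudoStep α (fun b => walkExpect α N b (fun p => F (consPath a p))) a := by
  have e : ∀ (b : Bool) (ε : Fin N → Bool),
      Fin.consEquiv (fun _ : Fin (N + 1) => Bool) (b, ε) = Fin.cons b ε := fun _ _ => rfl
  rw [walkExpect, ← (Fin.consEquiv fun _ : Fin (N + 1) => Bool).sum_comp, Fintype.sum_prod_type,
    Fintype.sum_bool]
  simp only [e, walkWeight_cons, walkPath_cons, pseudoStep, walkExpect,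
    Finset.mul_sum, if_true, Bool.false_eq_true, if_false, ← sub_eq_add_neg, Complex.ofReal_mul,
    mul_assoc]

lemma stepWeight_add_stepWeight (α : ℝ) (a : ℤ) :
    stepWeight α a (a + 1) + stepWeight α a (a - 1) = 1 := by
  have h : ¬ a - 1 = a + 1 := by omega
  simp only [stepWeight, if_true, if_neg h]
  split_ifs <;> ring

lemma walkExpect_one (α : ℝ) (N : ℕ) (a : ℤ) : walkExpect α N a (fun _ => 1) = 1 := by
  induction N generalizing a with
  | zero => simp [walkExpect, walkWeight]
  | succ N ih =>
    rw [walkExpect_succ]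
    simp only [ih, pseudoStep, mul_one]
    exact_mod_cast stepWeight_add_stepWeight α a

/-- This is the Markov property for a walk that is at `a` at time `r` and has `len` steps left. -/
lemma walkExpect_prod (α : ℝ) (ψ : ℝ → ℤ → ℂ) (len m r : ℕ) (s : Fin m → ℕ) (v : Fin m → ℝ)
    (a : ℤ) (hr : ∀ i, r ≤ s i) (hs : Monotone s) (hlen : ∀ i, s i ≤ r + len) :
    walkExpect α len a (fun p => ∏ i, ψ (v i) (p (s i - r)))
      = iterOp (fun N => (pseudoStep α)^[N]) ψ m r s v a := by
  -- Either the first observation time is the current time and its factor comes out, lowering `m`,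
  -- or the walk makes one step, lowering `len`.
  induction h : len + m using Nat.strong_induction_on generalizing len m r a with
  | _ k ih =>
  subst h
  rcases m with _ | m
  · simpa [iterOp] using walkExpect_one α len a
  rcases (hr 0).eq_or_lt with h0 | h0
  · have ih' := ih (len + m) (by omega) len m r (Fin.tail s) (Fin.tail v) a (fun i => hr _)
      (fun i j hij => hs (Fin.succ_le_succ_iff.2 hij)) (fun i => hlen _) rfl
    simp only [iterOp, ← h0, tsub_self, Function.iterate_zero, id]
    rw [← ih']
    simp only [walkExpect, Finset.mul_sum, Fin.prod_univ_succ, ← h0, tsub_self, walkPath_zero,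
      Fin.tail]
    exact Finset.sum_congr rfl fun ε _ => by ring
  · obtain _ | len := len
    · exact absurd (hlen 0) (by omega)
    have hr' : ∀ i, r + 1 ≤ s i := fun i => h0.trans_le (hs (Fin.zero_le i))
    rw [walkExpect_succ]
    have e : ∀ (p : ℕ → ℤ) (i), consPath a p (s i - r) = p (s i - (r + 1)) := fun p i => by
      have := hr' i
      rw [show s i - r = (s i - (r + 1)) + 1 by omega]; rfl
    simp only [e]
    rw [funext fun b => ih (len + (m + 1)) (by omega) len (m + 1) (r + 1) s v b hr' hs
      (fun i => by have := hlen i; omega) rfl]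
    simp only [iterOp]
    rw [show s 0 - r = (s 0 - (r + 1)) + 1 by omega, Function.iterate_succ_apply']

/-! ### The Walsh kernel -/

lemma gaussianPDFReal_zero_neg (t : ℝ≥0) (y : ℝ) :
    gaussianPDFReal 0 t (-y) = gaussianPDFReal 0 t y := by
  simp [gaussianPDFReal]

lemma integral_gaussianReal_comp_add {f : ℝ → ℂ} {t : ℝ≥0} (ht : t ≠ 0)
    (hf : Continuous f) (x : ℝ) :
    ∫ s, f (x + s) ∂(gaussianReal 0 t) = ∫ y, (gaussianPDFReal x t y : ℂ) * f y := by
  rw [← integral_map (φ := fun s => x + s) (by fun_prop) hf.aestronglyMeasurable,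
    gaussianReal_map_const_add, zero_add, integral_gaussianReal_eq_integral_smul ht]
  simp only [Complex.real_smul]

lemma BoundedLip.integrable_gaussianPDFReal_mul {K L : ℝ} {f : ℝ → ℂ} (h : BoundedLip K L f)
    (t : ℝ≥0) (x : ℝ) : Integrable (fun y => (gaussianPDFReal x t y : ℂ) * f y) :=
  (integrable_gaussianPDFReal x t).ofReal.mul_bdd h.continuous.aestronglyMeasurable
    (ae_of_all _ h.bound)

lemma integral_walshKernel_mul (β : ℝ) {K L : ℝ} {f : ℝ → ℂ} (h : BoundedLip K L f) {t : ℝ≥0}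
    (ht : t ≠ 0) (x : ℝ) :
    ∫ y, (walshKernel β t x y : ℂ) * f y = skewHeatOp β t f x := by
  have hne : ∀ᵐ y : ℝ, y ≠ 0 := (Set.countable_singleton (0 : ℝ)).ae_notMem _
  have hint := h.comp_neg.integrable_gaussianPDFReal_mul t x
  -- Kernel and folded Gaussian place the reflected mass on opposite half-lines: the integrands
  -- differ by a multiple of `φ (-y) - φ y`, whose integral vanishes. The set `S` is the half-line
  -- opposite the starting point.
  have key : ∀ (b : ℝ) (S : Set ℝ) (F : ℝ → ℂ), MeasurableSet S →
      Integrable (fun y => (gaussianPDFReal x t y : ℂ) * F y) →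
      (∀ y ≠ 0, (walshKernel β t x y : ℂ) * f y = (gaussianPDFReal x t y : ℂ) * F y
        + b * (S.indicator (fun y => (gaussianPDFReal x t y : ℂ) * f (-y)) (-y)
          - S.indicator (fun y => (gaussianPDFReal x t y : ℂ) * f (-y)) y)) →
      ∫ y, (walshKernel β t x y : ℂ) * f y = ∫ y, (gaussianPDFReal x t y : ℂ) * F y := by
    intro b S F hS hF hyp
    have hφ := hint.indicator hS
    set φ := S.indicator fun y => (gaussianPDFReal x t y : ℂ) * f (-y)
    have hd : Integrable (fun y => (b : ℂ) * (φ (-y) - φ y)) :=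
      (hφ.comp_neg.sub hφ).const_mul _
    rw [integral_congr_ae (hne.mono hyp), integral_add hF hd, integral_const_mul,
      integral_sub hφ.comp_neg hφ, integral_neg_eq_self φ, sub_self, mul_zero, add_zero]
  rw [skewHeatOp]
  split_ifs with hx
  · rw [integral_gaussianReal_comp_add ht (h.foldRight β).continuous]
    refine key β (Set.Iio 0) _ measurableSet_Iio
      ((h.foldRight β).integrable_gaussianPDFReal_mul t x) fun y hy => ?_
    rcases hy.lt_or_gt with hy | hy
    · rw [Set.indicator_of_notMem (by simpa using hy.le), Set.indicator_of_mem (by simpa using hy),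
        walshKernel, if_pos hy, if_pos hx, foldRight, abs_of_neg hy]
      push_cast; ring
    · rw [Set.indicator_of_mem (by simpa using hy), Set.indicator_of_notMem (by simpa using hy.le),
        walshKernel, if_neg hy.not_gt, if_pos hy, foldRight, abs_of_pos hy, neg_neg]
      split_ifs with hx0
      · obtain rfl := le_antisymm hx0 hx
        rw [gaussianPDFReal_zero_neg]
        push_cast; ring
      · push_cast; ring
  · rw [integral_gaussianReal_comp_add ht (h.foldLeft β).continuous]
    have hx' : x < 0 := not_le.1 hx
    refine key (-β) (Set.Ioi 0) _ measurableSet_Ioi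
      ((h.foldLeft β).integrable_gaussianPDFReal_mul t x) fun y hy => ?_
    rcases hy.lt_or_gt with hy | hy
    · rw [Set.indicator_of_mem (by simpa using hy), Set.indicator_of_notMem (by simpa using hy.le),
        walshKernel, if_pos hy, if_neg hx, foldLeft, abs_of_neg hy, neg_neg]
      push_cast; ring
    · rw [Set.indicator_of_notMem (by simpa using hy.le), Set.indicator_of_mem (by simpa using hy),
        walshKernel, if_neg hy.not_gt, if_pos hy, if_pos hx'.le, foldLeft, abs_of_pos hy]
      push_cast; ring

lemma abs_walshKernel_le (β : ℝ) (t : ℝ≥0) (x y : ℝ) :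
    |walshKernel β t x y| ≤
      (1 + |β|) * (gaussianPDFReal x t y + gaussianPDFReal x t (-y)) := by
  have h1 := gaussianPDFReal_nonneg x t y
  have h2 := gaussianPDFReal_nonneg x t (-y)
  have hb := abs_le.1 (le_refl |β|)
  have hb0 := abs_nonneg β
  have m1 := mul_le_mul_of_nonneg_right hb.1 h1
  have m2 := mul_le_mul_of_nonneg_right hb.2 h1
  have m3 := mul_le_mul_of_nonneg_right hb.1 h2
  have m4 := mul_le_mul_of_nonneg_right hb.2 h2
  have m5 := mul_nonneg hb0 h1
  have m6 := mul_nonneg hb0 h2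
  rw [walshKernel]
  split_ifs <;> rw [abs_le] <;> constructor <;> nlinarith

lemma measurable_walshKernel (β : ℝ) (t : ℝ≥0) :
    Measurable (fun p : ℝ × ℝ => walshKernel β t p.1 p.2) := by
  have h1 : Measurable (fun p : ℝ × ℝ => gaussianPDFReal p.1 t p.2) :=
    measurable_uncurry_gaussianPDFReal.comp
      (by fun_prop : Measurable fun p : ℝ × ℝ => (p.1, t, p.2))
  have h2 : Measurable (fun p : ℝ × ℝ => gaussianPDFReal p.1 t (-p.2)) :=
    measurable_uncurry_gaussianPDFReal.comp
      (by fun_prop : Measurable fun p : ℝ × ℝ => (p.1, t, -p.2))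
  unfold walshKernel
  refine Measurable.ite (measurableSet_lt (by fun_prop) (by fun_prop)) ?_ ?_
  · exact Measurable.ite (measurableSet_le (by fun_prop) (by fun_prop)) (by fun_prop) (by fun_prop)
  · refine Measurable.ite (measurableSet_lt (by fun_prop) (by fun_prop)) ?_ (by fun_prop)
    exact Measurable.ite (measurableSet_le (by fun_prop) (by fun_prop)) (by fun_prop) (by fun_prop)

lemma integrable_walshKernel (β : ℝ) (t : ℝ≥0) (x : ℝ) : Integrable (walshKernel β t x) := by
  have hg := integrable_gaussianPDFReal x t
  refine ((hg.add hg.comp_neg).const_mul (1 + |β|)).mono' ?_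
    (ae_of_all _ fun y => abs_walshKernel_le β t x y)
  exact ((measurable_walshKernel β t).comp (by fun_prop :
    Measurable fun y : ℝ => (x, y))).aestronglyMeasurable

lemma integral_gaussianPDFReal_le_one (x : ℝ) (t : ℝ≥0) : ∫ y, gaussianPDFReal x t y ≤ 1 := by
  rcases eq_or_ne t 0 with rfl | ht
  · simp
  · exact (integral_gaussianPDFReal_eq_one x ht).le

lemma integral_abs_walshKernel_le (β : ℝ) (t : ℝ≥0) (x : ℝ) :
    ∫ y, |walshKernel β t x y| ≤ (1 + |β|) * 2 := by
  have hg := integrable_gaussianPDFReal x t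
  refine (integral_mono (integrable_walshKernel β t x).abs ((hg.add hg.comp_neg).const_mul (1 + |β|))
    (abs_walshKernel_le β t x)).trans ?_
  rw [integral_const_mul]
  gcongr
  have := integral_add hg hg.comp_neg
  simp only [Pi.add_apply]
  rw [this, integral_neg_eq_self (gaussianPDFReal x t)]
  linarith [integral_gaussianPDFReal_le_one x t]

/-! ### The joint densities -/

/-- The joint density of the skew Brownian motion at the times `s₀ < s₁ < ⋯`, when it is at `x` at
time `r`. -/
noncomputable def walshDensityFrom (β : ℝ) (r : ℝ≥0) (x : ℝ) {m : ℕ} (s : Fin m → ℝ≥0)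
    (y : Fin m → ℝ) : ℝ :=
  ∏ i : Fin m, walshKernel β (s i - (Fin.cons r s : Fin (m + 1) → ℝ≥0) i.castSucc)
    ((Fin.cons x y : Fin (m + 1) → ℝ) i.castSucc) (y i)

lemma walshDensityFrom_cons (β : ℝ) (r : ℝ≥0) (x : ℝ) {m : ℕ} (s : Fin (m + 1) → ℝ≥0) (a : ℝ)
    (y : Fin m → ℝ) :
    walshDensityFrom β r x s (Fin.cons a y : Fin (m + 1) → ℝ)
      = walshKernel β (s 0 - r) x a * walshDensityFrom β (s 0) a (Fin.tail s) y := by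
  rw [walshDensityFrom, Fin.prod_univ_succ]
  simp only [Fin.castSucc_zero, Fin.cons_zero, ← Fin.succ_castSucc, Fin.cons_succ]
  rw [walshDensityFrom, Fin.cons_self_tail]
  rfl

lemma measurable_walshDensityFrom (β : ℝ) (r : ℝ≥0) {m : ℕ} (s : Fin m → ℝ≥0) :
    Measurable (fun p : ℝ × (Fin m → ℝ) => walshDensityFrom β r p.1 s p.2) := by
  have hk : ∀ k : Fin (m + 1),
      Measurable fun p : ℝ × (Fin m → ℝ) => (Fin.cons p.1 p.2 : Fin (m + 1) → ℝ) k := by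
    intro k
    rcases Fin.eq_zero_or_eq_succ k with rfl | ⟨j, rfl⟩
    · simpa only [Fin.cons_zero] using measurable_fst
    · simp only [Fin.cons_succ]; fun_prop
  have hi : ∀ i : Fin m, Measurable fun p : ℝ × (Fin m → ℝ) => p.2 i := fun i => by fun_prop
  exact Finset.measurable_fun_prod _ fun i _ =>
    (measurable_walshKernel β _).comp ((hk i.castSucc).prodMk (hi i))

lemma measurableEquiv_cons (m : ℕ) :
    ∃ e : (ℝ × (Fin m → ℝ)) ≃ᵐ (Fin (m + 1) → ℝ), MeasurePreserving e volume volume ∧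
      ∀ p, e p = Fin.cons p.1 p.2 :=
  ⟨(MeasurableEquiv.piFinSuccAbove (fun _ : Fin (m + 1) => ℝ) 0).symm,
    (volume_preserving_piFinSuccAbove (fun _ : Fin (m + 1) => ℝ) 0).symm,
    fun p => by
      simp [MeasurableEquiv.piFinSuccAbove_symm_apply, Fin.insertNthEquiv]⟩

/-- As the density may change sign, its integral does not control its absolute integral. Each kernel
has absolute mass at most `2 (1 + |β|)` uniformly in its starting point, so the bounds multiply
under Tonelli. -/
lemma integrable_walshDensityFrom (β : ℝ) (r : ℝ≥0) (x : ℝ) {m : ℕ} (s : Fin m → ℝ≥0) :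
    Integrable (walshDensityFrom β r x s) ∧
      ∫ y, ‖walshDensityFrom β r x s y‖ ≤ ((1 + |β|) * 2) ^ m := by
  induction m generalizing r x with
  | zero =>
    have e : walshDensityFrom β r x s = fun _ => 1 := by funext y; simp [walshDensityFrom]
    rw [e]
    refine ⟨?_, ?_⟩ <;> simp [volume_pi, measureReal_def]
  | succ m ih =>
    obtain ⟨e, he, hcons⟩ := measurableEquiv_cons m
    have hF : ∀ p : ℝ × (Fin m → ℝ), walshDensityFrom β r x s (e p) =
        walshKernel β (s 0 - r) x p.1 * walshDensityFrom β (s 0) p.1 (Fin.tail s) p.2 := fun p => by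
      rw [hcons, walshDensityFrom_cons]
    have hm : Measurable fun p : ℝ × (Fin m → ℝ) =>
        walshKernel β (s 0 - r) x p.1 * walshDensityFrom β (s 0) p.1 (Fin.tail s) p.2 :=
      ((measurable_walshKernel β (s 0 - r)).comp
        (by fun_prop : Measurable fun p : ℝ × (Fin m → ℝ) => (x, p.1))).mul
        (measurable_walshDensityFrom β (s 0) (Fin.tail s))
    have hle : ∀ a, ∫ y, ‖walshKernel β (s 0 - r) x a * walshDensityFrom β (s 0) a (Fin.tail s) y‖
        ≤ |walshKernel β (s 0 - r) x a| * ((1 + |β|) * 2) ^ m := by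
      intro a
      simp only [norm_mul]
      rw [integral_const_mul, Real.norm_eq_abs]
      gcongr
      exact (ih (s 0) a (Fin.tail s)).2
    have hbd : Integrable (fun a => |walshKernel β (s 0 - r) x a| * ((1 + |β|) * 2) ^ m) :=
      (integrable_walshKernel β (s 0 - r) x).abs.mul_const _
    have hi2 : Integrable (fun a => ∫ y,
        ‖walshKernel β (s 0 - r) x a * walshDensityFrom β (s 0) a (Fin.tail s) y‖) := by
      refine hbd.mono' ?_ (ae_of_all _ fun a => ?_)
      · exact (hm.stronglyMeasurable.norm.integral_prod_right' (ν := volume)).aestronglyMeasurable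
      · rw [Real.norm_of_nonneg (integral_nonneg fun y => norm_nonneg _)]
        exact hle a
    have hi : Integrable (fun p : ℝ × (Fin m → ℝ) =>
        walshKernel β (s 0 - r) x p.1 * walshDensityFrom β (s 0) p.1 (Fin.tail s) p.2) :=
      (integrable_prod_iff hm.aestronglyMeasurable).2
        ⟨ae_of_all _ fun a => (ih (s 0) a (Fin.tail s)).1.const_mul (walshKernel β (s 0 - r) x a), hi2⟩
    refine ⟨?_, ?_⟩
    · rw [← he.integrable_comp_emb e.measurableEmbedding]
      exact hi.congr (ae_of_all _ fun p => (hF p).symm)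
    · rw [← he.integral_comp e.measurableEmbedding]
      simp only [hF]
      rw [Measure.volume_eq_prod, integral_prod _ hi.norm, pow_succ']
      calc _ ≤ ∫ a, |walshKernel β (s 0 - r) x a| * ((1 + |β|) * 2) ^ m :=
            integral_mono hi2 hbd hle
        _ ≤ _ := by
            rw [integral_mul_const]
            gcongr
            exact integral_abs_walshKernel_le β _ x

lemma norm_prod_character {m : ℕ} (v y : Fin m → ℝ) : ‖∏ i, character (v i) (y i)‖ = 1 := by
  rw [norm_prod]
  exact Finset.prod_eq_one fun i _ => norm_exp_I_mul_real _

lemma continuous_prod_character {m : ℕ} (v : Fin m → ℝ) :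
    Continuous fun y : Fin m → ℝ => ∏ i, character (v i) (y i) := by
  refine continuous_finsetProd _ fun i _ => ?_
  exact (boundedLip_character (v i)).continuous.comp (continuous_apply i)

lemma integral_walshDensityFrom (β : ℝ) (r : ℝ≥0) (x : ℝ) {m : ℕ} (s : Fin m → ℝ≥0)
    (v : Fin m → ℝ) (hr : ∀ i, r < s i) (hs : StrictMono s) :
    ∫ y, (walshDensityFrom β r x s y : ℂ) * ∏ i, character (v i) (y i)
      = iterOp (skewHeatOp β) character m r s v x := by
  induction m generalizing r x with
  | zero => simp [walshDensityFrom, iterOp, volume_pi, measureReal_def]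
  | succ m ih =>
    obtain ⟨e, he, hcons⟩ := measurableEquiv_cons m
    have hr' : ∀ i, s 0 < Fin.tail s i := fun i => hs (Fin.succ_pos i)
    have hs' : StrictMono (Fin.tail s) := fun i j hij => hs (Fin.succ_lt_succ_iff.2 hij)
    have hint : Integrable (fun y : Fin (m + 1) → ℝ =>
        (walshDensityFrom β r x s y : ℂ) * ∏ i, character (v i) (y i)) :=
      (integrable_walshDensityFrom β r x s).1.ofReal.mul_bdd
        (continuous_prod_character v).aestronglyMeasurable
        (ae_of_all _ fun y => (norm_prod_character v y).le)
    have hint' : Integrable (fun p : ℝ × (Fin m → ℝ) =>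
        (walshDensityFrom β r x s (e p) : ℂ) * ∏ i, character (v i) (e p i)) :=
      (he.integrable_comp_emb e.measurableEmbedding).2 hint
    rw [← he.integral_comp e.measurableEmbedding, Measure.volume_eq_prod, integral_prod _ hint']
    -- The regularity of the inner function is inherited from the walks, of which it is a pointwise
    -- limit with uniform constants.
    obtain ⟨K, L, h1, h2⟩ := exists_boundedLip_iterOp β m (s 0) (Fin.tail s) (Fin.tail v)
      (fun i => (hr' i).le) hs'.monotone
    have h4 := (boundedLip_character (v 0)).mul (BoundedLip.of_tendsto h1 h2)
    rw [iterOp, ← integral_walshKernel_mul β h4 (tsub_pos_of_lt (hr 0)).ne']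
    congr 1 with a
    rw [← ih (s 0) a (Fin.tail s) (Fin.tail v) hr' hs', ← integral_const_mul, ← integral_const_mul]
    congr 1 with y
    rw [hcons, walshDensityFrom_cons, Fin.prod_univ_succ]
    simp only [Fin.cons_zero, Fin.cons_succ, Fin.tail]
    push_cast; ring

/-! ### Reduction to increasing positive times -/

/-- The sum of the coefficients `u j` with `t j = τ`. -/
noncomputable def coeffAt {ℓ : ℕ} (t : Fin ℓ → ℝ≥0) (u : Fin ℓ → ℝ) (τ : ℝ≥0) : ℝ :=
  ∑ j with t j = τ, u j

/-- Grouping coefficients of equal times replaces an unordered list with repetitions by increasing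
positive times. Time `0` is split off even when absent from the list; its coefficient is then an
empty sum. -/
lemma sum_mul_comp_eq {ℓ : ℕ} (t : Fin ℓ → ℝ≥0) (u : Fin ℓ → ℝ) (φ : ℝ≥0 → ℝ) :
    ∑ j, u j * φ (t j) = coeffAt t u 0 * φ 0 +
      ∑ i, coeffAt t u (((Finset.univ.image t).erase 0).orderEmbOfFin rfl i) *
        φ (((Finset.univ.image t).erase 0).orderEmbOfFin rfl i) := by
  classical
  set J := (Finset.univ.image t).erase 0 with hJ
  have h1 : ∑ j, u j * φ (t j) = ∑ τ ∈ insert 0 J, coeffAt t u τ * φ τ := by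
    rw [← Finset.sum_fiberwise_of_maps_to (t := insert 0 J) (g := t)]
    · refine Finset.sum_congr rfl fun τ _ => ?_
      rw [coeffAt, Finset.sum_mul]
      exact Finset.sum_congr rfl fun j hj => by rw [(Finset.mem_filter.1 hj).2]
    · intro j _
      rw [Finset.mem_insert, hJ, Finset.mem_erase]
      have := Finset.mem_image_of_mem t (Finset.mem_univ j)
      tauto
  rw [h1, Finset.sum_insert (by simp [hJ])]
  congr 1
  rw [← Finset.sum_coe_sort J, ← (J.orderIsoOfFin rfl).toEquiv.sum_comp]
  rfl

lemma exp_I_sum_eq {ℓ : ℕ} (t : Fin ℓ → ℝ≥0) (u : Fin ℓ → ℝ) (φ : ℝ≥0 → ℝ) :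
    Complex.exp (Complex.I * ((∑ j, u j * φ (t j) : ℝ) : ℂ)) =
      character (coeffAt t u 0) (φ 0) *
        ∏ i, character (coeffAt t u (((Finset.univ.image t).erase 0).orderEmbOfFin rfl i))
          (φ (((Finset.univ.image t).erase 0).orderEmbOfFin rfl i)) := by
  rw [sum_mul_comp_eq]
  simp only [character]
  rw [← Complex.exp_sum, ← Complex.exp_add]
  push_cast
  rw [mul_add, Finset.mul_sum]

lemma measurable_exp_I_sum {ℓ : ℕ} (t : Fin ℓ → ℝ≥0) (u : Fin ℓ → ℝ) :
    Measurable fun y : Finset.univ.image t → ℝ => Complex.exp (Complex.I *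
      ((∑ j, u j * y ⟨t j, Finset.mem_image_of_mem t (Finset.mem_univ j)⟩ : ℝ) : ℂ)) := by
  fun_prop

/-! ### Pseudo characteristic functions as iterated operators -/

lemma pseudoCharFun_rescaledWalk (α : ℝ) (m₀ : ℤ) (n : ℕ) {ℓ : ℕ} (t : Fin ℓ → ℝ≥0)
    (u : Fin ℓ → ℝ) :
    pseudoCharFun (rescaledWalk α m₀ n) t u =
      character (coeffAt t u 0) ((√(n : ℝ))⁻¹ * m₀) *
        iterOp (fun N => (pseudoStep α)^[N]) (fun v b => character v ((√(n : ℝ))⁻¹ * b))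
          _ 0
          (fun i => ⌊(n : ℝ≥0) * ((Finset.univ.image t).erase 0).orderEmbOfFin rfl i⌋₊)
          (fun i => coeffAt t u (((Finset.univ.image t).erase 0).orderEmbOfFin rfl i)) m₀ := by
  set I := Finset.univ.image t with hI
  set len := I.sup fun τ => ⌊(n : ℝ≥0) * τ⌋₊ with hlen
  have hmem : ∀ i, (I.erase 0).orderEmbOfFin rfl i ∈ I := fun i =>
    Finset.mem_of_mem_erase (Finset.orderEmbOfFin_mem _ _ i)
  rw [← walkExpect_prod α (fun v b => character v ((√(n : ℝ))⁻¹ * b)) len _ 0 _ _ m₀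
    (fun i => Nat.zero_le _)
    (fun i j hij => Nat.floor_mono (by gcongr))
    (fun i => by
      rw [zero_add]
      exact Finset.le_sup (f := fun τ : ℝ≥0 => ⌊(n : ℝ≥0) * τ⌋₊) (hmem i))]
  rw [pseudoCharFun, rescaledWalk, walkLaw]
  have hint : ∀ (X : Type) [MeasurableSpace X] [MeasurableSingletonClass X] (g : X → ℂ)
      (p : (Fin len → Bool) → X), ∀ ε ∈ (Finset.univ : Finset (Fin len → Bool)),
      (VectorMeasure.dirac (p ε) (walkWeight α m₀ ε)).Integrable g := by
    intro X _ _ g p ε _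
    rw [VectorMeasure.Integrable, VectorMeasure.variation_dirac]
    exact (integrable_dirac (by simp)).smul_measure (by simp)
  rw [VectorMeasure.integral_map (by fun_prop)
    (measurable_exp_I_sum t u).aestronglyMeasurable
    (VectorMeasure.Integrable.finsetSum_vectorMeasure (hint _ _ _)),
    VectorMeasure.integral_finsetSum_vectorMeasure (hint _ _ _), walkExpect, Finset.mul_sum]
  refine Finset.sum_congr rfl fun ε _ => ?_
  rw [VectorMeasure.integral_dirac]
  have := exp_I_sum_eq t u (fun τ => (√(n : ℝ))⁻¹ * walkPath m₀ ε ⌊(n : ℝ≥0) * τ⌋₊)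
  simp only [ContinuousLinearMap.flip_apply, ContinuousLinearMap.lsmul_apply, Complex.real_smul]
  rw [this, mul_zero, Nat.floor_zero, walkPath_zero]
  simp only [tsub_zero]
  ring

/-- Integration against a signed measure with a density. -/
lemma integral_withDensityᵥ {X : Type*} [MeasurableSpace X] {μ : Measure X} {f : X → ℝ}
    (hf : Integrable f μ) (hfm : Measurable f) {g : X → ℂ} (hg : Measurable g) {C : ℝ}
    (hC : ∀ x, ‖g x‖ ≤ C) :
    ∫ᵛ x, g x ∂<•(μ.withDensityᵥ f) = ∫ x, (f x : ℂ) * g x ∂μ := by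
  have := isFiniteMeasure_withDensity_ofReal hf.2
  have := isFiniteMeasure_withDensity_ofReal hf.neg.2
  have hb : ∀ (ν : Measure X) [IsFiniteMeasure ν], Integrable g ν := fun ν _ =>
    Integrable.of_bound hg.aestronglyMeasurable C (ae_of_all _ hC)
  have hb' : ∀ (ν : Measure X) [IsFiniteMeasure ν], ν.toSignedMeasure.Integrable g := fun ν _ => by
    rw [VectorMeasure.Integrable, Measure.variation_toSignedMeasure]; exact hb ν
  have hdens : ∀ h : X → ℝ, Measurable h →
      ∫ x, g x ∂(μ.withDensity fun x => ENNReal.ofReal (h x)) = ∫ x, (max (h x) 0 : ℝ) • g x ∂μ := by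
    intro h hh
    rw [integral_withDensity_eq_integral_toReal_smul (by fun_prop)
      (ae_of_all _ fun _ => ENNReal.ofReal_lt_top)]
    simp only [ENNReal.toReal_ofReal']
  -- Split the density as `f⁺ - f⁻`, integrate against two finite positive measures, and recombine
  -- pointwise.
  rw [withDensityᵥ_eq_withDensity_pos_part_sub_withDensity_neg_part hf,
    VectorMeasure.integral_sub_vectorMeasure (hb' _) (hb' _),
    VectorMeasure.integral_toSignedMeasure, VectorMeasure.integral_toSignedMeasure,
    hdens f hfm, hdens (fun x => -f x) hfm.neg, ← integral_sub]
  · congr 1 with x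
    rw [← sub_smul, Complex.real_smul]
    congr 2
    rcases le_total 0 (f x) with h | h
    · rw [max_eq_left h, max_eq_right (by linarith), sub_zero]
    · rw [max_eq_right h, max_eq_left (by linarith), zero_sub, neg_neg]
  · exact hf.pos_part.smul_bdd C hg.aestronglyMeasurable (ae_of_all _ hC)
  · exact hf.neg_part.smul_bdd C hg.aestronglyMeasurable (ae_of_all _ hC)

lemma pseudoCharFun_skewBrownianMotion (β x : ℝ) {ℓ : ℕ} (t : Fin ℓ → ℝ≥0) (u : Fin ℓ → ℝ) :
    pseudoCharFun (skewBrownianMotion β x) t u =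
      character (coeffAt t u 0) x *
        iterOp (skewHeatOp β) character _ 0
          (((Finset.univ.image t).erase 0).orderEmbOfFin rfl)
          (fun i => coeffAt t u (((Finset.univ.image t).erase 0).orderEmbOfFin rfl i)) x := by
  set I := Finset.univ.image t with hI
  set s := (I.erase 0).orderEmbOfFin rfl with hs
  rw [← integral_walshDensityFrom β 0 x s _ (fun i => pos_iff_ne_zero.2
    (Finset.ne_of_mem_erase (Finset.orderEmbOfFin_mem _ _ i))) s.strictMono]
  rw [pseudoCharFun, skewBrownianMotion]
  have hD := (integrable_walshDensityFrom β 0 x s).1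
  have hDm : Measurable (walshDensityFrom β 0 x s) :=
    (measurable_walshDensityFrom β 0 s).comp (by fun_prop : Measurable fun y => (x, y))
  have hφ : Measurable (fun (y : Fin (I.erase 0).card → ℝ) (τ : I) => if h : (τ : ℝ≥0) = 0 then x
      else y (((I.erase 0).orderIsoOfFin rfl).symm ⟨τ, Finset.mem_erase.2 ⟨h, τ.2⟩⟩)) := by
    refine measurable_pi_lambda _ fun τ => ?_
    split_ifs <;> fun_prop
  have hfin : IsFiniteMeasure
      ((volume : Measure (Fin (I.erase 0).card → ℝ)).withDensityᵥ
        (walshDensity β x s)).variation := by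
    rw [show walshDensity β x s = walshDensityFrom β 0 x s from rfl]
    rw [Measure.variation_withDensityᵥ hD]
    exact isFiniteMeasure_withDensity hD.2.ne
  rw [VectorMeasure.integral_map hφ (measurable_exp_I_sum t u).aestronglyMeasurable]
  swap
  · refine Integrable.of_bound (C := 1) ?_ (ae_of_all _ fun y => (norm_exp_I_mul_real _).le)
    exact ((measurable_exp_I_sum t u).comp hφ).aestronglyMeasurable
  refine (integral_withDensityᵥ hD hDm ((measurable_exp_I_sum t u).comp hφ) (C := 1)
    (fun y => (norm_exp_I_mul_real _).le)).trans ?_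
  rw [← integral_const_mul]
  congr 1 with y
  -- Testing membership in `I.erase 0` instead of `τ = 0` extends the coordinate map to all times,
  -- as the factorization of the exponential requires.
  have := exp_I_sum_eq t u (fun τ => if h : τ ∈ I.erase 0 then
    y (((I.erase 0).orderIsoOfFin rfl).symm ⟨τ, h⟩) else x)
  have e1 : ∀ j, (if h : t j = 0 then x else
      y (((I.erase 0).orderIsoOfFin rfl).symm ⟨t j, Finset.mem_erase.2
        ⟨h, Finset.mem_image_of_mem t (Finset.mem_univ j)⟩⟩)) =
      if h : t j ∈ I.erase 0 then y (((I.erase 0).orderIsoOfFin rfl).symm ⟨t j, h⟩) else x := by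
    intro j
    by_cases h : t j = 0
    · rw [dif_pos h, dif_neg (by simp [h])]
    · rw [dif_neg h, dif_pos]
  simp only [Function.comp_apply, e1]
  rw [this, dif_neg (by simp)]
  have e2 : ∀ i, (if h : s i ∈ I.erase 0 then
      y (((I.erase 0).orderIsoOfFin rfl).symm ⟨s i, h⟩) else x) = y i := by
    intro i
    rw [dif_pos (Finset.orderEmbOfFin_mem _ _ i)]
    congr 1
    rw [OrderIso.symm_apply_eq]
    rfl
  simp only [← hI, ← hs, e2]
  ring

end PseudoSBM

/-! ### Passage to the limit -/

open PseudoSBM in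
theorem mainTheorem3 (k : ℝ) (hk : k ≠ -1) (x : ℝ) :
    PseudoSBM.PseudoWeakTendsto
      (fun n : ℕ => PseudoSBM.rescaledWalk (1 / (1 + k)) ⌊√(n : ℝ) * x⌋ n)
      atTop
      (PseudoSBM.skewBrownianMotion ((1 - k) / (1 + k)) x) := by
  intro ℓ _ t u
  set β := (1 - k) / (1 + k) with hβ
  have hα : 1 / (1 + k) = (1 + β) / 2 := by
    have : 1 + k ≠ 0 := fun h => hk (by linarith)
    rw [hβ]; field_simp; ring
  set I := Finset.univ.image t with hI
  set s := (I.erase 0).orderEmbOfFin rfl with hs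
  have hz : Tendsto (fun n : ℕ => √(n : ℝ)) atTop atTop :=
    Real.tendsto_sqrt_atTop.comp tendsto_natCast_atTop_atTop
  have hx : Tendsto (fun n : ℕ => (√(n : ℝ))⁻¹ * (⌊√(n : ℝ) * x⌋ : ℝ)) atTop (𝓝 x) := by
    rw [← tendsto_sub_nhds_zero_iff]
    refine squeeze_zero_norm' ?_ (tendsto_inv_atTop_zero.comp hz)
    filter_upwards [eventually_gt_atTop 0] with n hn
    have hc : 0 < √(n : ℝ) := by positivity
    have e : (√(n : ℝ))⁻¹ * (⌊√(n : ℝ) * x⌋ : ℝ) - x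
        = (√(n : ℝ))⁻¹ * (⌊√(n : ℝ) * x⌋ - √(n : ℝ) * x) := by field_simp
    have h : |(⌊√(n : ℝ) * x⌋ : ℝ) - √(n : ℝ) * x| ≤ 1 := by
      rw [abs_le]
      constructor <;> linarith [Int.floor_le (√(n : ℝ) * x), Int.lt_floor_add_one (√(n : ℝ) * x)]
    rw [e, norm_mul, Real.norm_of_nonneg (by positivity), Real.norm_eq_abs, Function.comp_apply]
    exact mul_le_of_le_one_right (by positivity) h
  obtain ⟨K, L, h1, h2⟩ := exists_boundedLip_iterOp β _ 0 s (fun i => coeffAt t u (s i))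
    (fun i => zero_le) s.monotone
  simp only [mul_zero, Nat.floor_zero] at h1 h2
  rw [pseudoCharFun_skewBrownianMotion]
  have h3 : Tendsto (fun n : ℕ => character (coeffAt t u 0)
      ((√(n : ℝ))⁻¹ * (⌊√(n : ℝ) * x⌋ : ℝ))) atTop (𝓝 (character (coeffAt t u 0) x)) :=
    ((boundedLip_character _).continuous.tendsto x).comp hx
  -- The starting point also moves with `n`; the Lipschitz constant `L`, uniform in `n`, allows it
  -- to be replaced by `x`.
  have h4 : Tendsto (fun n : ℕ => iterOp (skewWalkOp β (√(n : ℝ))⁻¹) character _ 0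
      (fun i => ⌊(n : ℝ≥0) * s i⌋₊) (fun i => coeffAt t u (s i))
      ((√(n : ℝ))⁻¹ * (⌊√(n : ℝ) * x⌋ : ℝ))) atTop
      (𝓝 (iterOp (skewHeatOp β) character _ 0 s (fun i => coeffAt t u (s i)) x)) := by
    rw [← tendsto_sub_nhds_zero_iff] at hx
    have h5 : Tendsto (fun n : ℕ => L * |(√(n : ℝ))⁻¹ * (⌊√(n : ℝ) * x⌋ : ℝ) - x|) atTop (𝓝 0) := by
      simpa using hx.abs.const_mul L
    simpa using (squeeze_zero_norm (fun n => (h1 n).lip _ x) h5).add (h2 x)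
  refine (h3.mul h4).congr' ?_
  filter_upwards [eventually_gt_atTop 0] with n hn
  have hc : 0 < (√(n : ℝ))⁻¹ := by positivity
  rw [pseudoCharFun_rescaledWalk, hα, iterOp_pseudoStep β hc]
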